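/- Let $\lambda$ be a regular cardinal and let $\mathcal V=(\mathcal V_0,\otimes,I)$ be a complete and cocomplete symmetric monoidal closed category that is locally $\lambda$-presentable as a closed category (that is, $\mathcal V_0$ is locally $\lambda$-presentable, $I$ is $\lambda$-presentable, and $\lambda$-presentable objects are closed under $\otimes$). Let $(\mathcal E,\mathcal M)$ be an orthogonal factorization system on $\mathcal V_0$ such that: - it is proper (every $e\in\mathcal E$ is an epimorphism, every $m\in\mathcal M$ is a monomorphism) and enriched ($X\otimes e\in\mathcal E$ for all $e\in\mathcal E$, $X\in\mathcal V$); - $\mathcal M$ is closed under $\lambda$-filtered colimits in the category of arrows $\mathcal V^\to$; - there is a class $\mathcal H$ of morphisms of $\mathcal V^\to$, each of the form $(!_Z,y)\colon {!_X}\to d$ with $X$ a $\lambda$-presentable object of $\mathcal V$, $d\colon Z\to Y$, $y\colon X\to Y$, and $!_X\colon 0\to X$, $!_Z\colon 0\to Z$ the unique maps from the initial object, such that $\mathcal E$ consists exactly of the objects of $\mathcal V^\to$ that are injective with respect to every member of $\mathcal H$. For a $\mathcal V$-category $\mathcal K$, let $\mathcal K^\to$ be the $\mathcal V$-category of arrows;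 for $g\colon A\to B$ and $f\colon K\to L$ the object $\mathcal K^\to(g,f)$ is the pullback of $\mathcal K(A,f)\colon\mathcal K(A,K)\to\mathcal K(A,L)$ and $\mathcal K(g,L)\colon\mathcal K(B,L)\to\mathcal K(A,L)$. Let $\mathcal K^\to(g,f)\xrightarrow{p'}\mathcal Q(g,f)\xrightarrow{p''}\mathcal K(A,K)$ be the $(\mathcal E,\mathcal M)$-factorization of the projection, let $q'\colon\mathcal K(B,K)\to\mathcal K^\to(g,f)$ be the map induced by $\mathcal K(g,K)$ and $\mathcal K(B,f)$, and put $q=p'q'$. The morphism $f$ is barely $\mathcal E$-pure with respect to $g$ if $q\in\mathcal E$, and barely $(\lambda,\mathcal E)$-pure if this holds for all $g\colon A\to B$ with $A$ and $B$ $\lambda$-presentable in the enriched sense ($\mathcal K(A,-)$ and $\mathcal K(B,-)$ preserve conical $\lambda$-filtered colimits). 1. Let $\mathcal K$ be a locally $\lambda$-presentable $\mathcal V$-category, that is, $\mathcal K$ has all small conical colimits and all copowers, its (enriched) $\lambda$-presentable objects form an essentially small class, and every object is a small conical $\lambda$-filtered colimit of $\lambda$-presentable objects. Then a morphism $f$ of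 $\mathcal K$ is barely $(\lambda,\mathcal E)$-pure if and only if $f$ is a conical colimit in $\mathcal K^\to$ of a small $\lambda$-filtered diagram $\mathcal D$ such that $f$ is barely $\mathcal E$-pure with respect to each member of $\mathcal D$. 2. In any $\mathcal V$-category $\mathcal K$, every $\mathcal E$-split monomorphism, i.e. every morphism $s\colon K\to L$ such that $\mathcal K(s,K)\colon\mathcal K(L,K)\to\mathcal K(K,K)$ is in $\mathcal E$, is barely $(\lambda,\mathcal E)$-pure. In particular this holds in every locally $\lambda$-presentable $\mathcal V$-category. -/

import Mathlib

open CategoryTheory Category Limits MonoidalCategory Opposite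

universe w u₁ u₂ u₃

namespace EnrichedPurity

noncomputable section

/-! ### The enriched category of arrows -/

section ArrowCategory

variable (V : Type u₁) [Category.{w} V] [MonoidalCategory V]
variable {C : Type u₂} [Category.{w} C] [EnrichedOrdinaryCategory V C]

lemma eHomEquiv_comp_whiskerLeft {X Y Z : C} (f : X ⟶ Y) (g : Y ⟶ Z) :
    eHomEquiv V f ≫ eHomWhiskerLeft V X g = eHomEquiv V (f ≫ g) := by
  rw [eHomEquiv_comp, tensorHom_def_assoc, eHomWhiskerLeft, rightUnitor_inv_naturality_assoc,
    unitors_inv_equal]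

lemma eHomEquiv_comp_whiskerRight {X Y Z : C} (f : X ⟶ Y) (g : Y ⟶ Z) :
    eHomEquiv V g ≫ eHomWhiskerRight V f Z = eHomEquiv V (f ≫ g) := by
  rw [eHomEquiv_comp, tensorHom_def'_assoc, eHomWhiskerRight, leftUnitor_inv_naturality_assoc]

lemma whiskerLeft_eHomWhiskerRight_eComp {X Y Y' Z : C} (φ : Y ⟶ Y') :
    (X ⟶[V] Y) ◁ eHomWhiskerRight V φ Z ≫ eComp V X Y Z =
      eHomWhiskerLeft V X φ ▷ (Y' ⟶[V] Z) ≫ eComp V X Y' Z := by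
  dsimp [eHomWhiskerLeft, eHomWhiskerRight]
  simp only [MonoidalCategory.whiskerLeft_comp_assoc, whisker_assoc_symm,
    triangle_assoc_comp_left_inv_assoc, e_assoc', comp_whiskerRight, assoc]

variable [HasPullbacks V]

/-- The hom-object `C^→(g, f)` of the `V`-category of arrows, for `g : A ⟶ B` and `f : K ⟶ L`:
the pullback of `C(A, f) : C(A, K) ⟶ C(A, L)` and `C(g, L) : C(B, L) ⟶ C(A, L)`. -/
def arrowHom (g f : Arrow C) : V :=
  pullback (eHomWhiskerLeft V g.left f.hom) (eHomWhiskerRight V g.hom f.right)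

/-- The projection `p : C^→(g, f) ⟶ C(A, K)`, `(u, v) ↦ u`. -/
def arrowHomLeft (g f : Arrow C) : arrowHom V g f ⟶ (g.left ⟶[V] f.left) :=
  pullback.fst _ _

/-- The projection `C^→(g, f) ⟶ C(B, L)`, `(u, v) ↦ v`. -/
def arrowHomRight (g f : Arrow C) : arrowHom V g f ⟶ (g.right ⟶[V] f.right) :=
  pullback.snd _ _

lemma arrowHom_w (g f : Arrow C) :
    arrowHomLeft V g f ≫ eHomWhiskerLeft V g.left f.hom =
      arrowHomRight V g f ≫ eHomWhiskerRight V g.hom f.right :=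
  pullback.condition

/-- The morphism into `C^→(g, f)` given by the universal property of the pullback. -/
def arrowLift {g f : Arrow C} {X : V} (a : X ⟶ (g.left ⟶[V] f.left))
    (b : X ⟶ (g.right ⟶[V] f.right))
    (h : a ≫ eHomWhiskerLeft V g.left f.hom = b ≫ eHomWhiskerRight V g.hom f.right) :
    X ⟶ arrowHom V g f :=
  pullback.lift a b h

@[simp]
lemma arrowLift_left {g f : Arrow C} {X : V} (a : X ⟶ (g.left ⟶[V] f.left))
    (b : X ⟶ (g.right ⟶[V] f.right))
    (h : a ≫ eHomWhiskerLeft V g.left f.hom = b ≫ eHomWhiskerRight V g.hom f.right) :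
    arrowLift V a b h ≫ arrowHomLeft V g f = a :=
  pullback.lift_fst _ _ _

@[simp]
lemma arrowLift_right {g f : Arrow C} {X : V} (a : X ⟶ (g.left ⟶[V] f.left))
    (b : X ⟶ (g.right ⟶[V] f.right))
    (h : a ≫ eHomWhiskerLeft V g.left f.hom = b ≫ eHomWhiskerRight V g.hom f.right) :
    arrowLift V a b h ≫ arrowHomRight V g f = b :=
  pullback.lift_snd _ _ _

lemma arrowHom_ext {g f : Arrow C} {X : V} {a b : X ⟶ arrowHom V g f}
    (h₁ : a ≫ arrowHomLeft V g f = b ≫ arrowHomLeft V g f)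
    (h₂ : a ≫ arrowHomRight V g f = b ≫ arrowHomRight V g f) : a = b :=
  pullback.hom_ext h₁ h₂

/-- The identity of `f` in the `V`-category of arrows. -/
def arrowId (f : Arrow C) : 𝟙_ V ⟶ arrowHom V f f :=
  arrowLift V (eId V f.left) (eId V f.right) (by
    rw [← eHomEquiv_id, ← eHomEquiv_id, eHomEquiv_comp_whiskerLeft, eHomEquiv_comp_whiskerRight,
      id_comp, comp_id])

/-- The composition of the `V`-category of arrows, componentwise. -/
def arrowComp (f g h : Arrow C) : arrowHom V f g ⊗ arrowHom V g h ⟶ arrowHom V f h :=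
  arrowLift V
    ((arrowHomLeft V f g ⊗ₘ arrowHomLeft V g h) ≫ eComp V f.left g.left h.left)
    ((arrowHomRight V f g ⊗ₘ arrowHomRight V g h) ≫ eComp V f.right g.right h.right)
    (by
      rw [assoc, assoc, eComp_eHomWhiskerLeft, eComp_eHomWhiskerRight,
        tensorHom_comp_whiskerLeft_assoc, tensorHom_comp_whiskerRight_assoc, arrowHom_w V g h,
        ← arrowHom_w V f g, ← tensorHom_comp_whiskerLeft_assoc,
        whiskerLeft_eHomWhiskerRight_eComp, tensorHom_comp_whiskerRight_assoc])

lemma arrow_id_comp (f g : Arrow C) :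
    (λ_ (arrowHom V f g)).inv ≫ arrowId V f ▷ _ ≫ arrowComp V f f g = 𝟙 _ := by
  apply arrowHom_ext
  · simp only [arrowComp, arrowId, assoc, arrowLift_left, whiskerRight_comp_tensorHom_assoc,
      leftUnitor_inv_comp_tensorHom_assoc, e_id_comp, comp_id, id_comp]
  · simp only [arrowComp, arrowId, assoc, arrowLift_right, whiskerRight_comp_tensorHom_assoc,
      leftUnitor_inv_comp_tensorHom_assoc, e_id_comp, comp_id, id_comp]

lemma arrow_comp_id (f g : Arrow C) :
    (ρ_ (arrowHom V f g)).inv ≫ _ ◁ arrowId V g ≫ arrowComp V f g g = 𝟙 _ := by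
  apply arrowHom_ext
  · simp only [arrowComp, arrowId, assoc, arrowLift_left, whiskerLeft_comp_tensorHom_assoc,
      rightUnitor_inv_comp_tensorHom_assoc, e_comp_id, comp_id, id_comp]
  · simp only [arrowComp, arrowId, assoc, arrowLift_right, whiskerLeft_comp_tensorHom_assoc,
      rightUnitor_inv_comp_tensorHom_assoc, e_comp_id, comp_id, id_comp]

lemma arrow_assoc (f g h k : Arrow C) :
    (α_ (arrowHom V f g) (arrowHom V g h) (arrowHom V h k)).inv ≫
        arrowComp V f g h ▷ _ ≫ arrowComp V f h k =
      _ ◁ arrowComp V g h k ≫ arrowComp V f g k := by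
  apply arrowHom_ext
  · simp only [arrowComp, assoc, arrowLift_left, whiskerRight_comp_tensorHom_assoc,
      whiskerLeft_comp_tensorHom_assoc]
    rw [← tensorHom_comp_whiskerRight_assoc, ← tensorHom_comp_whiskerLeft_assoc, ← e_assoc,
      associator_inv_naturality_assoc]
  · simp only [arrowComp, assoc, arrowLift_right, whiskerRight_comp_tensorHom_assoc,
      whiskerLeft_comp_tensorHom_assoc]
    rw [← tensorHom_comp_whiskerRight_assoc, ← tensorHom_comp_whiskerLeft_assoc, ← e_assoc,
      associator_inv_naturality_assoc]

/-- Morphisms `g ⟶ f` in the category of arrows of `C` are the global elements of `C^→(g, f)`. -/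
def arrowHomEquiv (g f : Arrow C) : (g ⟶ f) ≃ (𝟙_ V ⟶ arrowHom V g f) where
  toFun φ := arrowLift V (eHomEquiv V φ.left) (eHomEquiv V φ.right) (by
    rw [eHomEquiv_comp_whiskerLeft, eHomEquiv_comp_whiskerRight, Arrow.w])
  invFun a := Arrow.homMk ((eHomEquiv V).symm (a ≫ arrowHomLeft V g f))
    ((eHomEquiv V).symm (a ≫ arrowHomRight V g f)) (by
      apply (eHomEquiv V).injective
      rw [← eHomEquiv_comp_whiskerLeft, ← eHomEquiv_comp_whiskerRight, Equiv.apply_symm_apply,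
        Equiv.apply_symm_apply, assoc, assoc, arrowHom_w])
  left_inv φ := by ext <;> simp
  right_inv a := by apply arrowHom_ext <;> simp

/-- The `V`-category of arrows `C^→` of a `V`-category `C`; its underlying ordinary category is
`Arrow C`. -/
instance arrowEnrichedOrdinaryCategory : EnrichedOrdinaryCategory V (Arrow C) where
  Hom := arrowHom V
  id := arrowId V
  comp := arrowComp V
  id_comp := arrow_id_comp V
  comp_id := arrow_comp_id V
  assoc := arrow_assoc V
  homEquiv {g f} := arrowHomEquiv V g f
  homEquiv_id f := by
    apply arrowHom_ext
    · exact (arrowLift_left V _ _ _).trans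
        ((eHomEquiv_id V f.left).trans (arrowLift_left V _ _ _).symm)
    · exact (arrowLift_right V _ _ _).trans
        ((eHomEquiv_id V f.right).trans (arrowLift_right V _ _ _).symm)
  homEquiv_comp {f g h} φ ψ := by
    change arrowHomEquiv V f h (φ ≫ ψ) = (λ_ (𝟙_ V)).inv ≫
      (arrowHomEquiv V f g φ ⊗ₘ arrowHomEquiv V g h ψ) ≫ arrowComp V f g h
    apply arrowHom_ext
    · simp [arrowHomEquiv, arrowComp, eHomEquiv_comp]
    · simp [arrowHomEquiv, arrowComp, eHomEquiv_comp]

end ArrowCategory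

/-! ### Conical colimits, copowers and enriched local presentability -/

section Presentability

variable (V : Type u₁) [Category.{w} V] [MonoidalCategory V]
variable {C : Type u₂} [Category.{w} C] [EnrichedOrdinaryCategory V C]

/-- A cocone `c` over an ordinary functor `F : J ⥤ C` exhibits its point as the conical colimit
of `F` in the `V`-category `C`: for every `Y`, the induced cone exhibits `C(c.pt, Y)` as the limit
of `C(F -, Y)` in `V`. -/
def IsConicalColimit {J : Type w} [SmallCategory J] {F : J ⥤ C} (c : Cocone F) : Prop :=
  ∀ Y : C, Nonempty (IsLimit (((eHomFunctor V C).flip.obj Y).mapCone c.op))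

/-- `X` is `κ`-presentable in the enriched sense: `C(X, -) : C ⥤ V` preserves conical `κ`-filtered
colimits. -/
def IsEnrichedPresentable (κ : Cardinal.{w}) [Fact κ.IsRegular] (X : C) : Prop :=
  ∀ (J : Type w) [SmallCategory J] [IsCardinalFiltered J κ] (F : J ⥤ C) (c : Cocone F),
    IsConicalColimit V c → Nonempty (IsColimit ((eCoyoneda V X).mapCocone c))

/-- The canonical morphism `C(P, Y) ⟶ [X, C(K, Y)]` attached to `η : X ⟶ C(K, P)`. -/
def copowerComparison [MonoidalClosed V] {X : V} {K P : C} (η : X ⟶ (K ⟶[V] P)) (Y : C) :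
    (P ⟶[V] Y) ⟶ (ihom X).obj (K ⟶[V] Y) :=
  MonoidalClosed.curry (η ▷ (P ⟶[V] Y) ≫ eComp V K P Y)

/-- `η : X ⟶ C(K, P)` exhibits `P` as the copower of `K` by `X`. -/
def IsCopower [MonoidalClosed V] {X : V} {K P : C} (η : X ⟶ (K ⟶[V] P)) : Prop :=
  ∀ Y : C, IsIso (copowerComparison V η Y)

variable (C) in
/-- `C` is locally `κ`-presentable as a `V`-category: it is cocomplete (it has all small conical
colimits and all copowers), its `κ`-presentable objects form an essentially small class, and every
object is a (small, conical) `κ`-filtered colimit of `κ`-presentable objects. -/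
structure IsEnrichedLocallyPresentable [MonoidalClosed V] (κ : Cardinal.{w}) [Fact κ.IsRegular] :
    Prop where
  exists_conicalColimit (J : Type w) [SmallCategory J] (F : J ⥤ C) :
    ∃ c : Cocone F, IsConicalColimit V c
  exists_copower (X : V) (K : C) : ∃ (P : C) (η : X ⟶ (K ⟶[V] P)), IsCopower V η
  essentiallySmall_presentable :
    ObjectProperty.EssentiallySmall.{w} (fun X : C => IsEnrichedPresentable V κ X)
  exists_presentation (X : C) :
    ∃ (J : Type w) (_ : SmallCategory J) (_ : IsCardinalFiltered J κ) (F : J ⥤ C) (c : Cocone F),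
      IsConicalColimit V c ∧ Nonempty (c.pt ≅ X) ∧ ∀ j, IsEnrichedPresentable V κ (F.obj j)

/-- The monoidal category `V` is locally `κ`-presentable as a closed category. -/
structure IsLocallyPresentableAsClosedCategory (κ : Cardinal.{w}) [Fact κ.IsRegular] : Prop where
  isCardinalLocallyPresentable : IsCardinalLocallyPresentable V κ
  isCardinalPresentable_unit : IsCardinalPresentable (𝟙_ V) κ
  isCardinalPresentable_tensor (X Y : V) :
    IsCardinalPresentable X κ → IsCardinalPresentable Y κ → IsCardinalPresentable (X ⊗ Y) κ

end Presentability

/-! ### Factorization systems -/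

section Factorization

variable {V : Type u₁} [Category.{w} V]

/-- `(E, M)` is an (orthogonal) factorization system. -/
class IsFactorizationSystem (E M : MorphismProperty V) : Prop
    extends E.HasFactorization M where
  isomorphisms_le_left : MorphismProperty.isomorphisms V ≤ E
  isomorphisms_le_right : MorphismProperty.isomorphisms V ≤ M
  left_comp : E.IsStableUnderComposition
  right_comp : M.IsStableUnderComposition
  orthogonal {A B X Y : V} (e : A ⟶ B) (m : X ⟶ Y) (a : A ⟶ X) (b : B ⟶ Y) :
    E e → M m → a ≫ m = e ≫ b → ∃! d : B ⟶ X, e ≫ d = a ∧ d ≫ m = b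

/-- The object `T` is injective with respect to the morphism `h`. -/
def IsInjectiveWrt {D : Type*} [Category* D] {P Q : D} (h : P ⟶ Q) (T : D) : Prop :=
  ∀ φ : P ⟶ T, ∃ ψ : Q ⟶ T, h ≫ ψ = φ

/-- For `d : Z ⟶ Y` and `y : X ⟶ Y`, the morphism `(!_Z, y) : !_X ⟶ d` in the category of arrows,
where `!_X : 0 ⟶ X` and `!_Z : 0 ⟶ Z` are the unique morphisms out of the initial object. -/
def initialSquare [HasInitial V] {X Y Z : V} (d : Z ⟶ Y) (y : X ⟶ Y) :
    Arrow.mk (initial.to X) ⟶ Arrow.mk d :=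
  Arrow.homMk (initial.to Z) y (initialIsInitial.hom_ext _ _)

/-- The standing assumption on the factorization system `(E, M)`:
* it is proper: morphisms in `E` are epimorphisms and morphisms in `M` are monomorphisms;
* it is enriched: `X ⊗ e` is in `E` whenever `e` is in `E`;
* `M` is closed under `κ`-filtered colimits in the category of arrows;
* `E` is the class of arrows that are injective with respect to some class `H` of morphisms
  `(!_Z, y) : !_X ⟶ d` of arrows, with `X` a `κ`-presentable object of `V`. -/
structure StandingAssumption [MonoidalCategory V] [HasInitial V] (κ : Cardinal.{w})
    [Fact κ.IsRegular] (E M : MorphismProperty V) : Prop where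
  left_le_epimorphisms : E ≤ MorphismProperty.epimorphisms V
  right_le_monomorphisms : M ≤ MorphismProperty.monomorphisms V
  enriched {A B : V} (e : A ⟶ B) (X : V) : E e → E (X ◁ e)
  right_colimits (J : Type w) [SmallCategory J] [IsCardinalFiltered J κ] :
    M.IsStableUnderColimitsOfShape J
  left_eq_injectives : ∃ H : ∀ ⦃X Y Z : V⦄, (Z ⟶ Y) → (X ⟶ Y) → Prop,
    (∀ ⦃X Y Z : V⦄ (d : Z ⟶ Y) (y : X ⟶ Y), H d y → IsCardinalPresentable X κ) ∧
    ∀ ⦃A B : V⦄ (e : A ⟶ B), E e ↔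
      ∀ ⦃X Y Z : V⦄ (d : Z ⟶ Y) (y : X ⟶ Y), H d y →
        IsInjectiveWrt (initialSquare d y) (Arrow.mk e)

end Factorization

/-! ### Bare purity -/

section Purity

variable {V : Type u₁} [Category.{w} V] [MonoidalCategory V] [HasPullbacks V]
variable (E M : MorphismProperty V)
variable {C : Type u₂} [Category.{w} C] [EnrichedOrdinaryCategory V C]

/-- The `(E, M)`-factorization of the projection `p : C^→(g, f) ⟶ C(A, K)`. Its middle object is
`Q(g, f)`. -/
def projectionFactorization [E.HasFactorization M] (g f : Arrow C) :
    E.MapFactorizationData M (arrowHomLeft V g f) :=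
  MorphismProperty.factorizationData E M (arrowHomLeft V g f)

variable (V) in
/-- The morphism `q' : C(B, K) ⟶ C^→(g, f)`, `t ↦ (t g, f t)`, for `g : A ⟶ B`, `f : K ⟶ L`. -/
def diagonalToArrowHom (g f : Arrow C) : (g.right ⟶[V] f.left) ⟶ arrowHom V g f :=
  arrowLift V (eHomWhiskerRight V g.hom f.left) (eHomWhiskerLeft V g.right f.hom)
    (eHom_whisker_exchange V g.hom f.hom).symm

/-- `f` is barely `E`-pure with respect to `g`: the composite `q : C(B, K) ⟶ Q(g, f)` of
`q' : C(B, K) ⟶ C^→(g, f)` and `p' : C^→(g, f) ⟶ Q(g, f)` is in `E`. -/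
def IsBarelyPureWrt [E.HasFactorization M] (f g : Arrow C) : Prop :=
  E (diagonalToArrowHom V g f ≫ (projectionFactorization E M g f).i)

/-- `f` is barely `(κ, E)`-pure. -/
def IsBarelyPure [E.HasFactorization M] (κ : Cardinal.{w}) [Fact κ.IsRegular] (f : Arrow C) :
    Prop :=
  ∀ {A B : C} (g : A ⟶ B), IsEnrichedPresentable V κ A → IsEnrichedPresentable V κ B →
    IsBarelyPureWrt E M f (Arrow.mk g)

/-- `s : K ⟶ L` is an `E`-split monomorphism: `C(s, K) : C(L, K) ⟶ C(K, K)` is in `E`. -/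
def IsSplitMonoWrt {K L : C} (s : K ⟶ L) : Prop :=
  E (eHomWhiskerRight V s K)

/-- `f` is the colimit, in the `V`-category of arrows `C^→`, of a `κ`-filtered family `F` such
that `f` is barely `E`-pure with respect to each member of `F`. -/
def IsFilteredColimitOfBarelyPureFor [E.HasFactorization M] (κ : Cardinal.{w})
    [Fact κ.IsRegular] (f : Arrow C) : Prop :=
  ∃ (J : Type w) (_ : SmallCategory J) (_ : IsCardinalFiltered J κ) (F : J ⥤ Arrow C)
    (c : Cocone F), IsConicalColimit V c ∧ Nonempty (c.pt ≅ f) ∧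
      ∀ j, IsBarelyPureWrt E M f (F.obj j)

end Purity

end

end EnrichedPurity

/-! The objects `Q(g, f)` compose like hom-objects. Since `E` is closed under `⊗`, orthogonality
makes the composition of `C^→` descend to `Q(g, h) ⊗ Q(h, f) ⟶ Q(g, f)` (`middleComp`), and a square
`g ⟶ h` followed by a diagonal for `h` and `f` gives a diagonal for `g` and `f`. Hence purity
transfers (`isBarelyPureWrt_of_forall_exists`): a generalized element of `Q(g, f)` coming from `Q(g,
h)` along some `φ : h ⟶ f`, with `f` pure with respect to `h`, is covered by a morphism of `E`. The
description of `E` by injectivity allows testing on elements with `κ`-presentable domain only.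

For an `E`-split monomorphism `s`, take `h = s` and `φ = 𝟙`: `C(s, K)` is `q` followed by `p''`, so
its membership in `E` forces `p''` to be invertible, and `s` is pure with respect to itself.

If `f` is a `κ`-filtered colimit of arrows `F j` and `g` has presentable ends, then `C^→(g, f)` and
`C(A, K)` are the colimits of the corresponding hom-objects. As `M` is closed under `κ`-filtered
colimits, `colim Q(g, F j) ⟶ C(A, K)` is in `M`, and orthogonality gives `Q(g, f) ⟶ colim Q(g, F
j)`; so elements of `Q(g, f)` come from some `Q(g, F j)` (`exists_comp_middleMap_eq`) and purity
transfers.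

Conversely, every arrow is a `κ`-filtered colimit of arrows with presentable ends
(`exists_colimitsOfShape_hasPresentableEnds`). This colimit is conical because its components are
(`isConicalColimit_arrow`), and enriched and ordinary presentability agree, so bare purity applies
to each member. -/

namespace EnrichedPurity

noncomputable section

/-! ### Orthogonal factorization systems -/

section Factorization

variable {V : Type u₁} [Category.{w} V] {E M : MorphismProperty V} [IsFactorizationSystem E M]

/-- The diagonal filler of a commutative square with left side in `E` and right side in `M`. -/
def diagonalFiller {A B X Y : V} {e : A ⟶ B} {m : X ⟶ Y} (he : E e) (hm : M m)
    (a : A ⟶ X) (b : B ⟶ Y) (h : a ≫ m = e ≫ b) : B ⟶ X :=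
  (IsFactorizationSystem.orthogonal e m a b he hm h).exists.choose

lemma comp_diagonalFiller {A B X Y : V} {e : A ⟶ B} {m : X ⟶ Y} (he : E e) (hm : M m)
    (a : A ⟶ X) (b : B ⟶ Y) (h : a ≫ m = e ≫ b) : e ≫ diagonalFiller he hm a b h = a :=
  (IsFactorizationSystem.orthogonal e m a b he hm h).exists.choose_spec.1

lemma diagonalFiller_comp {A B X Y : V} {e : A ⟶ B} {m : X ⟶ Y} (he : E e) (hm : M m)
    (a : A ⟶ X) (b : B ⟶ Y) (h : a ≫ m = e ≫ b) : diagonalFiller he hm a b h ≫ m = b :=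
  (IsFactorizationSystem.orthogonal e m a b he hm h).exists.choose_spec.2

variable (M) in
include M in
lemma left_comp_mem {X Y Z : V} {f : X ⟶ Y} {g : Y ⟶ Z} (hf : E f) (hg : E g) : E (f ≫ g) := by
  have := IsFactorizationSystem.left_comp (E := E) (M := M)
  exact E.comp_mem _ _ hf hg

variable (M) in
include M in
lemma left_of_isIso {X Y : V} (f : X ⟶ Y) [IsIso f] : E f :=
  IsFactorizationSystem.isomorphisms_le_left (M := M) f ‹IsIso f›

/-- A monomorphism in `M` through which a morphism in `E` factors is invertible. -/
lemma isIso_of_comp_mem_left {X Y Z : V} {a : X ⟶ Y} {m : Y ⟶ Z} (hm : M m) [Mono m]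
    (h : E (a ≫ m)) : IsIso m := by
  -- Filling the square with bottom side `𝟙 Z` gives a section of `m`; a split epimorphism that is
  -- monic is invertible.
  have h₁ := diagonalFiller_comp h hm a (𝟙 Z) (comp_id _).symm
  exact ⟨_, by rw [← cancel_mono m, assoc, h₁, comp_id, id_comp], h₁⟩

end Factorization

/-! ### Consequences of the standing assumption: testing membership in `E`, tensor products -/

section StandingAssumption

variable {V : Type u₁} [Category.{w} V] [MonoidalCategory V] [HasInitial V]
  {κ : Cardinal.{w}} [Fact κ.IsRegular] {E M : MorphismProperty V}

lemma StandingAssumption.mono (hEM : StandingAssumption κ E M) {X Y : V} {m : X ⟶ Y} (hm : M m) :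
    Mono m :=
  hEM.right_le_monomorphisms m hm

/-- `e` belongs to `E` as soon as every morphism from a `κ`-presentable object to its target
factors through some morphism of `E` over `e`. -/
lemma StandingAssumption.left_of_forall_exists (hEM : StandingAssumption κ E M) {A B : V}
    (e : A ⟶ B)
    (h : ∀ (X : V) (_ : IsCardinalPresentable X κ) (x : X ⟶ B),
      ∃ (A' B' : V) (e' : A' ⟶ B') (a : A' ⟶ A) (b : B' ⟶ B) (x' : X ⟶ B'),
        E e' ∧ a ≫ e = e' ≫ b ∧ x' ≫ b = x) : E e := by
  obtain ⟨H, hH, hE⟩ := hEM.left_eq_injectives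
  rw [hE]
  intro X Y Z d y hdy φ
  obtain ⟨A', B', e', a, b, x', he', hab, hx'⟩ := h X (hH d y hdy) φ.right
  -- A morphism `!_X ⟶ e'` carries no data beyond `X ⟶ B'`, so `x'` defines one. It extends along
  -- the member of `H` because `e'` is in `E`, and the extension is then pushed to `e` along `(a,
  -- b)`.
  obtain ⟨ψ, hψ⟩ := (hE e').1 he' d y hdy
    (Arrow.homMk (initial.to A') x' (initialIsInitial.hom_ext _ _))
  have hψ' : y ≫ ψ.right = x' := congr_arg CommaMorphism.right hψ
  have hw : ψ.left ≫ e' = d ≫ ψ.right := ψ.w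
  refine ⟨Arrow.homMk (ψ.left ≫ a) (ψ.right ≫ b) ?_, ?_⟩
  · change (ψ.left ≫ a) ≫ e = d ≫ ψ.right ≫ b
    rw [assoc, hab, reassoc_of% hw]
  · ext
    · exact initialIsInitial.hom_ext _ _
    · change y ≫ ψ.right ≫ b = _
      rw [reassoc_of% hψ', hx']

/-- Enrichment only provides `X ◁ e`; the other whiskering is conjugate to it by the braiding. -/
lemma StandingAssumption.tensorHom_mem [BraidedCategory V] [IsFactorizationSystem E M]
    (hEM : StandingAssumption κ E M) {X X' Y Y' : V} {e : X ⟶ X'} {e' : Y ⟶ Y'}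
    (he : E e) (he' : E e') : E (e ⊗ₘ e') := by
  have : e ⊗ₘ e' = (β_ X Y).hom ≫ Y ◁ e ≫ (β_ X' Y).inv ≫ X' ◁ e' := by
    simp [MonoidalCategory.tensorHom_def]
  rw [this]
  exact left_comp_mem M (left_of_isIso M _) (left_comp_mem M (hEM.enriched _ _ he)
    (left_comp_mem M (left_of_isIso M _) (hEM.enriched _ _ he')))

end StandingAssumption

/-! ### The composition of the middle objects `Q(g, f)` -/

section MiddleObject

variable {V : Type u₁} [Category.{w} V] [MonoidalCategory V] [HasPullbacks V]
variable {C : Type u₂} [Category.{w} C] [EnrichedOrdinaryCategory V C]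

variable (V) in
/-- The morphism `C^→(g, h) ⟶ C^→(g, f)` induced by `φ : h ⟶ f`. -/
def arrowHomMap (g : Arrow C) {h f : Arrow C} (φ : h ⟶ f) : arrowHom V g h ⟶ arrowHom V g f :=
  arrowLift V (arrowHomLeft V g h ≫ eHomWhiskerLeft V g.left φ.left)
    (arrowHomRight V g h ≫ eHomWhiskerLeft V g.right φ.right) (by
      rw [assoc, assoc, eHom_whisker_exchange, ← reassoc_of% arrowHom_w V g h,
        ← eHomWhiskerLeft_comp, ← eHomWhiskerLeft_comp, Arrow.w])

lemma arrowHomMap_left (g : Arrow C) {h f : Arrow C} (φ : h ⟶ f) :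
    arrowHomMap V g φ ≫ arrowHomLeft V g f =
      arrowHomLeft V g h ≫ eHomWhiskerLeft V g.left φ.left :=
  arrowLift_left _ _ _ _

lemma arrowHomMap_right (g : Arrow C) {h f : Arrow C} (φ : h ⟶ f) :
    arrowHomMap V g φ ≫ arrowHomRight V g f =
      arrowHomRight V g h ≫ eHomWhiskerLeft V g.right φ.right :=
  arrowLift_right _ _ _ _

lemma diagonalToArrowHom_left (g f : Arrow C) :
    diagonalToArrowHom V g f ≫ arrowHomLeft V g f = eHomWhiskerRight V g.hom f.left :=
  arrowLift_left _ _ _ _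

lemma diagonalToArrowHom_right (g f : Arrow C) :
    diagonalToArrowHom V g f ≫ arrowHomRight V g f = eHomWhiskerLeft V g.right f.hom :=
  arrowLift_right _ _ _ _

variable (V) in
-- On elements: for `(u, v) : g ⟶ h` and a diagonal `t`, the composite `(t h u, f t v)` equals `(t v
-- g, f t v)`, because `h u = v g`. So `t v` is the resulting diagonal.
lemma whiskerLeft_diagonalToArrowHom_arrowComp (g h f : Arrow C) :
    arrowHom V g h ◁ diagonalToArrowHom V h f ≫ arrowComp V g h f =
      (arrowHomRight V g h ▷ _ ≫ eComp V g.right h.right f.left) ≫ diagonalToArrowHom V g f := by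
  apply arrowHom_ext
  · simp only [arrowComp, assoc, arrowLift_left, diagonalToArrowHom_left,
      whiskerLeft_comp_tensorHom_assoc, eComp_eHomWhiskerRight]
    rw [MonoidalCategory.tensorHom_def_assoc, whiskerLeft_eHomWhiskerRight_eComp,
      ← comp_whiskerRight_assoc, ← comp_whiskerRight_assoc, arrowHom_w]
  · simp only [arrowComp, assoc, arrowLift_right, diagonalToArrowHom_right,
      whiskerLeft_comp_tensorHom_assoc, eComp_eHomWhiskerLeft]
    rw [MonoidalCategory.tensorHom_def_assoc]

variable {κ : Cardinal.{w}} [Fact κ.IsRegular] {E M : MorphismProperty V}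
  [IsFactorizationSystem E M]

/-- The morphism `Q(g, h) ⟶ Q(g, f)` induced by `φ : h ⟶ f`. -/
def middleMap (E M : MorphismProperty V) [IsFactorizationSystem E M]
    (g : Arrow C) {h f : Arrow C} (φ : h ⟶ f) :
    (projectionFactorization E M g h).Z ⟶ (projectionFactorization E M g f).Z :=
  diagonalFiller (projectionFactorization E M g h).hi (projectionFactorization E M g f).hp
    (arrowHomMap V g φ ≫ (projectionFactorization E M g f).i)
    ((projectionFactorization E M g h).p ≫ eHomWhiskerLeft V g.left φ.left)
    (by simp [arrowHomMap_left])

lemma i_middleMap (g : Arrow C) {h f : Arrow C} (φ : h ⟶ f) :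
    (projectionFactorization E M g h).i ≫ middleMap E M g φ =
      arrowHomMap V g φ ≫ (projectionFactorization E M g f).i :=
  comp_diagonalFiller _ _ _ _ _

lemma middleMap_p (g : Arrow C) {h f : Arrow C} (φ : h ⟶ f) :
    middleMap E M g φ ≫ (projectionFactorization E M g f).p =
      (projectionFactorization E M g h).p ≫ eHomWhiskerLeft V g.left φ.left :=
  diagonalFiller_comp _ _ _ _ _

variable [BraidedCategory V] [HasInitial V]

/-- The composition `Q(g, h) ⊗ Q(h, f) ⟶ Q(g, f)`. -/
def middleComp (hEM : StandingAssumption κ E M) (g h f : Arrow C) :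
    (projectionFactorization E M g h).Z ⊗ (projectionFactorization E M h f).Z ⟶
      (projectionFactorization E M g f).Z :=
  diagonalFiller
    (hEM.tensorHom_mem (projectionFactorization E M g h).hi (projectionFactorization E M h f).hi)
    (projectionFactorization E M g f).hp
    (arrowComp V g h f ≫ (projectionFactorization E M g f).i)
    (((projectionFactorization E M g h).p ⊗ₘ (projectionFactorization E M h f).p) ≫
      eComp V g.left h.left f.left)
    (by simp [arrowComp])

lemma tensorHom_i_middleComp (hEM : StandingAssumption κ E M) (g h f : Arrow C) :
    ((projectionFactorization E M g h).i ⊗ₘ (projectionFactorization E M h f).i) ≫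
      middleComp hEM g h f = arrowComp V g h f ≫ (projectionFactorization E M g f).i :=
  comp_diagonalFiller _ _ _ _ _

lemma middleComp_p (hEM : StandingAssumption κ E M) (g h f : Arrow C) :
    middleComp hEM g h f ≫ (projectionFactorization E M g f).p =
    ((projectionFactorization E M g h).p ⊗ₘ (projectionFactorization E M h f).p) ≫
      eComp V g.left h.left f.left :=
  diagonalFiller_comp _ _ _ _ _

/-- The action of `φ` on `Q(g, -)` is composition with the global element of `Q(h, f)` named by `φ`.
Since `p''` is monic, this can be checked in `C(A, K)`, where both sides postcompose with `φ.left`.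
-/
lemma middleMap_eq_middleComp (hEM : StandingAssumption κ E M) (g : Arrow C) {h f : Arrow C}
    (φ : h ⟶ f) :
    (ρ_ _).inv ≫ (projectionFactorization E M g h).Z ◁
      (arrowHomEquiv V h f φ ≫ (projectionFactorization E M h f).i) ≫ middleComp hEM g h f =
      middleMap E M g φ := by
  have := hEM.mono (projectionFactorization E M g f).hp
  have h₁ : arrowHomEquiv V h f φ ≫ arrowHomLeft V h f = eHomEquiv V φ.left :=
    arrowLift_left _ _ _ _
  rw [← cancel_mono (projectionFactorization E M g f).p, middleMap_p, assoc, assoc, middleComp_p,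
    whiskerLeft_comp_tensorHom_assoc, assoc, MorphismProperty.MapFactorizationData.fac, h₁,
    MonoidalCategory.tensorHom_def_assoc, ← rightUnitor_inv_naturality_assoc, eHomWhiskerLeft]

/-- If `f` is barely `E`-pure with respect to `h` and every morphism from a `κ`-presentable object
to `Q(g, f)` factors through the morphism induced by a morphism `h ⟶ f`, for a suitable such `h`,
then `f` is barely `E`-pure with respect to `g`. -/
lemma isBarelyPureWrt_of_forall_exists (hEM : StandingAssumption κ E M) (g f : Arrow C)
    (H : ∀ (X : V) (_ : IsCardinalPresentable X κ) (x : X ⟶ (projectionFactorization E M g f).Z),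
      ∃ (h : Arrow C) (φ : h ⟶ f) (y : X ⟶ (projectionFactorization E M g h).Z),
        IsBarelyPureWrt E M f h ∧ y ≫ middleMap E M g φ = x) :
    IsBarelyPureWrt E M f g := by
  refine hEM.left_of_forall_exists _ (fun X hX x ↦ ?_)
  obtain ⟨h, φ, y, hf, rfl⟩ := H X hX x
  -- The covering morphism of `E` is the tensor of `C^→(g, h) ⟶ Q(g, h)` with the map `q` for `h`
  -- and `f`; it is sent to `q` for `g` and `f` by `(v, t) ↦ t v` and `middleComp`. The lift of `x`
  -- pairs `y` with the element named by `φ`.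
  refine ⟨_, _, (projectionFactorization E M g h).i ⊗ₘ
      (diagonalToArrowHom V h f ≫ (projectionFactorization E M h f).i),
    arrowHomRight V g h ▷ _ ≫ eComp V g.right h.right f.left, middleComp hEM g h f,
    y ≫ (ρ_ _).inv ≫ (projectionFactorization E M g h).Z ◁
      (arrowHomEquiv V h f φ ≫ (projectionFactorization E M h f).i),
    hEM.tensorHom_mem (projectionFactorization E M g h).hi hf, ?_, ?_⟩
  · have := whiskerLeft_diagonalToArrowHom_arrowComp V g h f =≫
      (projectionFactorization E M g f).i
    rw [← assoc, ← this, assoc, ← tensorHom_i_middleComp hEM, ← assoc, whiskerLeft_comp_tensorHom]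
  · rw [assoc, assoc, middleMap_eq_middleComp]

/-- `E`-split monomorphisms are barely `E`-pure with respect to every morphism. -/
lemma IsSplitMonoWrt.isBarelyPureWrt (hEM : StandingAssumption κ E M) {K L : C} {s : K ⟶ L}
    (hs : IsSplitMonoWrt E s) (g : Arrow C) : IsBarelyPureWrt E M (Arrow.mk s) g := by
  -- With `h = s` and `φ = 𝟙` every `x` factors trivially, so only purity of `s` with respect to
  -- itself remains.
  refine isBarelyPureWrt_of_forall_exists hEM g _ (fun X _ x ↦ ⟨Arrow.mk s, 𝟙 _, x, ?_, ?_⟩)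
  · let F := projectionFactorization (V := V) E M (Arrow.mk s) (Arrow.mk s)
    have := hEM.mono F.hp
    have h : (diagonalToArrowHom V (Arrow.mk s) (Arrow.mk s) ≫ F.i) ≫ F.p =
        eHomWhiskerRight V s K := by
      rw [assoc, F.fac, diagonalToArrowHom_left]
      rfl
    have : IsIso F.p := isIso_of_comp_mem_left F.hp (by rw [h]; exact hs)
    rw [← IsIso.eq_comp_inv] at h
    change E (_ ≫ F.i)
    rw [h]
    exact left_comp_mem M hs (left_of_isIso M _)
  · have := hEM.mono (projectionFactorization E M g (Arrow.mk s)).hp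
    rw [← cancel_mono (projectionFactorization E M g (Arrow.mk s)).p, assoc, middleMap_p]
    simp

end MiddleObject

/-! ### `κ`-filtered colimits of hom-objects of the category of arrows -/

section FilteredColimits

variable {V : Type u₁} [Category.{w} V] {κ : Cardinal.{w}} [Fact κ.IsRegular]
variable {J : Type w} [SmallCategory J] [IsCardinalFiltered J κ]

/-- A cocone over a `κ`-filtered diagram in a locally `κ`-presentable category is a colimit if the
`κ`-presentable objects see it as a colimit. -/
lemma nonempty_isColimit_of_isCardinalPresentable [IsCardinalLocallyPresentable V κ] {F : J ⥤ V}
    (c : Cocone F)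
    (hs : ∀ (X : V) (_ : IsCardinalPresentable X κ) (x : X ⟶ c.pt),
      ∃ (j : J) (y : X ⟶ F.obj j), y ≫ c.ι.app j = x)
    (hi : ∀ (X : V) (_ : IsCardinalPresentable X κ) (j : J) (u v : X ⟶ F.obj j),
      u ≫ c.ι.app j = v ≫ c.ι.app j → ∃ (k : J) (a : j ⟶ k), u ≫ F.map a = v ≫ F.map a) :
    Nonempty (IsColimit c) := by
  have := isFiltered_of_isCardinalFiltered J κ
  obtain ⟨P, _, hP⟩ := HasCardinalFilteredGenerator.exists_generator V κ
  -- The comparison `colim F ⟶ c.pt` is monic by `hi` and surjective on elements from generators by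
  -- `hs`; for a strong generator this makes it invertible.
  have : Mono (colimit.desc F c) := by
    rw [hP.isStrongGenerator.isSeparating.mono_iff]
    intro G hG g₁ g₂ hg
    have : IsCardinalPresentable G κ := hP.le_isCardinalPresentable _ hG
    obtain ⟨j₁, f₁, rfl⟩ :=
      IsCardinalPresentable.exists_hom_of_isColimit κ (colimit.isColimit F) g₁
    obtain ⟨j₂, f₂, rfl⟩ :=
      IsCardinalPresentable.exists_hom_of_isColimit κ (colimit.isColimit F) g₂
    obtain ⟨k, a, ha⟩ := hi G this (IsFiltered.max j₁ j₂)
      (f₁ ≫ F.map (IsFiltered.leftToMax j₁ j₂)) (f₂ ≫ F.map (IsFiltered.rightToMax j₁ j₂))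
      (by simpa using hg)
    simpa using ha =≫ colimit.ι F k
  have : IsIso ((colimit.isColimit F).desc c) :=
    hP.isStrongGenerator.isIso_of_mono (colimit.desc F c) (fun G hG x ↦ by
      obtain ⟨j, y, rfl⟩ := hs G (hP.le_isCardinalPresentable _ hG) x
      exact ⟨y ≫ colimit.ι F j, by simp⟩)
  exact ⟨IsColimit.ofPointIso (colimit.isColimit F)⟩

variable [MonoidalCategory V] [HasPullbacks V]
variable {C : Type u₂} [Category.{w} C] [EnrichedOrdinaryCategory V C]

variable (V) in
/-- The functor `f ↦ C^→(g, f)`. -/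
@[simps]
def arrowHomFunctor (g : Arrow C) : Arrow C ⥤ V where
  obj f := arrowHom V g f
  map φ := arrowHomMap V g φ
  map_id f := by
    apply arrowHom_ext
    · simp [arrowHomMap_left]
    · simp [arrowHomMap_right]
  map_comp φ ψ := by
    apply arrowHom_ext
    · rw [assoc, arrowHomMap_left, arrowHomMap_left, reassoc_of% arrowHomMap_left g φ,
        Arrow.comp_left, eHomWhiskerLeft_comp]
    · rw [assoc, arrowHomMap_right, arrowHomMap_right, reassoc_of% arrowHomMap_right g φ,
        Arrow.comp_right, eHomWhiskerLeft_comp]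

/-- This is the commutation of `κ`-filtered colimits with pullbacks, checked on elements with
`κ`-presentable domain. Besides the colimits of the two legs, that of the `C(A, L_j)` is needed to
make a pair of components into a square at some stage. -/
lemma nonempty_isColimit_arrowHomFunctor [IsCardinalLocallyPresentable V κ] (g : Arrow C)
    {F : J ⥤ Arrow C} (c : Cocone F)
    (h₁ : IsColimit ((Arrow.leftFunc ⋙ eCoyoneda V g.left).mapCocone c))
    (h₂ : IsColimit ((Arrow.rightFunc ⋙ eCoyoneda V g.right).mapCocone c))
    (h₃ : IsColimit ((Arrow.rightFunc ⋙ eCoyoneda V g.left).mapCocone c)) :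
    Nonempty (IsColimit ((arrowHomFunctor V g).mapCocone c)) := by
  have := isFiltered_of_isCardinalFiltered J κ
  refine nonempty_isColimit_of_isCardinalPresentable (κ := κ) _ (fun X _ x ↦ ?_)
    (fun X _ j u v huv ↦ ?_)
  · change X ⟶ arrowHom V g c.pt at x
    obtain ⟨j₁, a, ha⟩ := IsCardinalPresentable.exists_hom_of_isColimit κ h₁
      (x ≫ arrowHomLeft V g c.pt)
    obtain ⟨j₂, b, hb⟩ := IsCardinalPresentable.exists_hom_of_isColimit κ h₂
      (x ≫ arrowHomRight V g c.pt)
    change X ⟶ (g.left ⟶[V] (F.obj j₁).left) at a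
    change X ⟶ (g.right ⟶[V] (F.obj j₂).right) at b
    change a ≫ eHomWhiskerLeft V g.left (c.ι.app j₁).left = _ at ha
    change b ≫ eHomWhiskerLeft V g.right (c.ι.app j₂).right = _ at hb
    have hab : (a ≫ eHomWhiskerLeft V g.left (F.obj j₁).hom) ≫
          eHomWhiskerLeft V g.left (c.ι.app j₁).right =
        (b ≫ eHomWhiskerRight V g.hom (F.obj j₂).right) ≫
          eHomWhiskerLeft V g.left (c.ι.app j₂).right := by
      rw [assoc, assoc, ← eHom_whisker_exchange, reassoc_of% hb, ← eHomWhiskerLeft_comp,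
        ← Arrow.w, eHomWhiskerLeft_comp, reassoc_of% ha]
      exact (assoc _ _ _).trans ((x ≫= arrowHom_w V g c.pt).trans (assoc _ _ _).symm)
    -- The two composites agree in `C(A, L)`, hence already at a stage `k` receiving both `j₁` and
    -- `j₂`.
    obtain ⟨k, s, t, hst⟩ := IsCardinalPresentable.exists_eq_of_isColimit κ h₃
      (i₁ := j₁) (i₂ := j₂) _ _ hab
    replace hst : (a ≫ eHomWhiskerLeft V g.left (F.obj j₁).hom) ≫
          eHomWhiskerLeft V g.left (F.map s).right =
        (b ≫ eHomWhiskerRight V g.hom (F.obj j₂).right) ≫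
          eHomWhiskerLeft V g.left (F.map t).right := hst
    refine ⟨k, arrowLift V (a ≫ eHomWhiskerLeft V g.left (F.map s).left)
      (b ≫ eHomWhiskerLeft V g.right (F.map t).right) ?_, ?_⟩
    · rw [assoc, assoc, ← eHomWhiskerLeft_comp, Arrow.w, eHomWhiskerLeft_comp,
        eHom_whisker_exchange, ← assoc, hst, assoc]
    · change _ ≫ arrowHomMap V g (c.ι.app k) = x
      apply arrowHom_ext
      · rw [assoc, arrowHomMap_left, ← assoc, arrowLift_left, assoc, ← eHomWhiskerLeft_comp,
          ← Arrow.comp_left, c.w, ha]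
        rfl
      · rw [assoc, arrowHomMap_right, ← assoc, arrowLift_right, assoc, ← eHomWhiskerLeft_comp,
          ← Arrow.comp_right, c.w, hb]
        rfl
  · change X ⟶ arrowHom V g (F.obj j) at u v
    change u ≫ arrowHomMap V g (c.ι.app j) = v ≫ arrowHomMap V g (c.ι.app j) at huv
    obtain ⟨k₁, a, ha⟩ := IsCardinalPresentable.exists_eq_of_isColimit' κ h₁ (i := j)
      (u ≫ arrowHomLeft V g _) (v ≫ arrowHomLeft V g _) (by
        change (_ ≫ _) ≫ eHomWhiskerLeft V g.left (c.ι.app j).left =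
          (_ ≫ _) ≫ eHomWhiskerLeft V g.left (c.ι.app j).left
        rw [assoc, assoc, ← arrowHomMap_left, reassoc_of% huv])
    obtain ⟨k₂, b, hb⟩ := IsCardinalPresentable.exists_eq_of_isColimit' κ h₂ (i := j)
      (u ≫ arrowHomRight V g _) (v ≫ arrowHomRight V g _) (by
        change (_ ≫ _) ≫ eHomWhiskerLeft V g.right (c.ι.app j).right =
          (_ ≫ _) ≫ eHomWhiskerLeft V g.right (c.ι.app j).right
        rw [assoc, assoc, ← arrowHomMap_right, reassoc_of% huv])
    change (_ ≫ _) ≫ eHomWhiskerLeft V g.left (F.map a).left =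
      (_ ≫ _) ≫ eHomWhiskerLeft V g.left (F.map a).left at ha
    change (_ ≫ _) ≫ eHomWhiskerLeft V g.right (F.map b).right =
      (_ ≫ _) ≫ eHomWhiskerLeft V g.right (F.map b).right at hb
    obtain ⟨k, s, t, hst⟩ := IsFiltered.span a b
    refine ⟨k, a ≫ s, ?_⟩
    change u ≫ arrowHomMap V g (F.map (a ≫ s)) = v ≫ arrowHomMap V g (F.map (a ≫ s))
    apply arrowHom_ext
    · rw [assoc, assoc, arrowHomMap_left, F.map_comp, Arrow.comp_left, eHomWhiskerLeft_comp]
      simpa only [assoc] using ha =≫ eHomWhiskerLeft V g.left (F.map s).left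
    · rw [assoc, assoc, arrowHomMap_right, hst, F.map_comp, Arrow.comp_right,
        eHomWhiskerLeft_comp]
      simpa only [assoc] using hb =≫ eHomWhiskerLeft V g.right (F.map t).right

variable [HasInitial V] {E M : MorphismProperty V} [IsFactorizationSystem E M]

/-- The functor `f ↦ Q(g, f)`. -/
@[simps]
def middleFunctor (hEM : StandingAssumption κ E M) (g : Arrow C) : Arrow C ⥤ V where
  obj f := (projectionFactorization E M g f).Z
  map φ := middleMap E M g φ
  map_id f := by
    have := hEM.mono (projectionFactorization E M g f).hp
    simp [← cancel_mono (projectionFactorization E M g f).p, middleMap_p]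
  map_comp {f₁ f₂ f₃} φ ψ := by
    have := hEM.mono (projectionFactorization E M g f₃).hp
    rw [← cancel_mono (projectionFactorization E M g f₃).p, assoc, middleMap_p, middleMap_p,
      reassoc_of% middleMap_p (E := E) (M := M) g φ, Arrow.comp_left, eHomWhiskerLeft_comp]

/-- Morphisms from `κ`-presentable objects to `Q(g, f)` factor through some `Q(g, F j)` when
`C^→(g, f)` and `C(A, K)` are the colimits of the `C^→(g, F j)` and of the `C(A, K_j)`. -/
lemma exists_comp_middleMap_eq [IsCardinalLocallyPresentable V κ]
    (hEM : StandingAssumption κ E M) (g : Arrow C) {F : J ⥤ Arrow C} (c : Cocone F)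
    (h₁ : IsColimit ((Arrow.leftFunc ⋙ eCoyoneda V g.left).mapCocone c))
    (h₂ : IsColimit ((arrowHomFunctor V g).mapCocone c))
    {X : V} [IsCardinalPresentable X κ] (x : X ⟶ (projectionFactorization E M g c.pt).Z) :
    ∃ (j : J) (y : X ⟶ (projectionFactorization E M g (F.obj j)).Z),
      y ≫ middleMap E M g (c.ι.app j) = x := by
  let Q := F ⋙ middleFunctor hEM g
  let s : Cocone Q := ⟨(g.left ⟶[V] c.pt.left),
    { app j := (projectionFactorization E M g (F.obj j)).p ≫
        eHomWhiskerLeft V g.left (c.ι.app j).left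
      naturality i j a := by
        change middleMap E M g (F.map a) ≫ (projectionFactorization E M g (F.obj j)).p ≫
            eHomWhiskerLeft V g.left (c.ι.app j).left =
          ((projectionFactorization E M g (F.obj i)).p ≫
            eHomWhiskerLeft V g.left (c.ι.app i).left) ≫ 𝟙 (g.left ⟶[V] c.pt.left)
        rw [reassoc_of% middleMap_p (E := E) (M := M) g (F.map a), ← eHomWhiskerLeft_comp,
          ← Arrow.comp_left, c.w]
        exact (comp_id _).symm }⟩
  let m : colimit Q ⟶ (g.left ⟶[V] c.pt.left) := colimit.desc Q s
  let q (j : J) : (projectionFactorization E M g (F.obj j)).Z ⟶ colimit Q := colimit.ι Q j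
  have hι (j : J) : q j ≫ m = (projectionFactorization E M g (F.obj j)).p ≫
      eHomWhiskerLeft V g.left (c.ι.app j).left := colimit.ι_desc s j
  -- As an arrow, `m` is the colimit of the `p''` for the `F j`, all of them in `M`.
  have hm : M m := (hEM.right_colimits J).condition Q (F ⋙ Arrow.leftFunc ⋙ eCoyoneda V g.left)
    _ _ (colimit.isColimit Q) h₁
    { app j := (projectionFactorization E M g (F.obj j)).p
      naturality _ _ a := middleMap_p _ _ }
    (fun j ↦ (projectionFactorization E M g (F.obj j)).hp) m hι
  have hq {i j : J} (a : i ⟶ j) : middleMap E M g (F.map a) ≫ q j = q i := colimit.w Q a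
  let t : Cocone (F ⋙ arrowHomFunctor V g) := ⟨colimit Q,
    { app j := (projectionFactorization E M g (F.obj j)).i ≫ q j
      naturality i j a := by
        have : arrowHomMap V g (F.map a) ≫ (projectionFactorization E M g (F.obj j)).i ≫ q j =
            (projectionFactorization E M g (F.obj i)).i ≫ q i := by
          rw [← reassoc_of% i_middleMap (E := E) (M := M) g (F.map a), hq]
        exact this.trans (comp_id _).symm }⟩
  let e : arrowHom V g c.pt ⟶ colimit Q := h₂.desc t
  have he (j : J) : arrowHomMap V g (c.ι.app j) ≫ e =
      (projectionFactorization E M g (F.obj j)).i ≫ q j := h₂.fac t j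
  have hem : e ≫ m = (projectionFactorization E M g c.pt).i ≫
      (projectionFactorization E M g c.pt).p := by
    refine h₂.hom_ext (fun j ↦ ?_)
    have : arrowHomMap V g (c.ι.app j) ≫ e ≫ m =
        arrowHomMap V g (c.ι.app j) ≫ (projectionFactorization E M g c.pt).i ≫
          (projectionFactorization E M g c.pt).p := by
      rw [reassoc_of% he j, MorphismProperty.MapFactorizationData.fac, hι,
        MorphismProperty.MapFactorizationData.fac_assoc]
      exact (arrowHomMap_left _ _).symm
    exact this
  -- The element `x` is moved into `colim Q` by this filler, where presentability of `X` provides a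
  -- stage; monicity of `p''` brings the equation back to `Q(g, f)`.
  let d : (projectionFactorization E M g c.pt).Z ⟶ colimit Q :=
    diagonalFiller (projectionFactorization E M g c.pt).hi hm e
      (projectionFactorization E M g c.pt).p hem
  have hd : d ≫ m = (projectionFactorization E M g c.pt).p := diagonalFiller_comp _ _ _ _ _
  obtain ⟨j, y, hy⟩ : ∃ (j : J) (y : X ⟶ (projectionFactorization E M g (F.obj j)).Z),
      y ≫ q j = x ≫ d :=
    IsCardinalPresentable.exists_hom_of_isColimit κ (colimit.isColimit Q) (x ≫ d)
  have := hEM.mono (projectionFactorization E M g c.pt).hp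
  refine ⟨j, y, ?_⟩
  rw [← cancel_mono (projectionFactorization E M g c.pt).p, assoc]
  refine (y ≫= (middleMap_p _ _).trans (hι j).symm).trans ?_
  rw [← hd, ← assoc x, ← hy, assoc]

end FilteredColimits

/-! ### Conical colimits in a `V`-category and in its category of arrows -/

section Conical

variable {V : Type u₁} [Category.{w} V] [MonoidalCategory V]
variable {C : Type u₂} [Category.{w} C] [EnrichedOrdinaryCategory V C]
variable {J : Type w} [SmallCategory J]

/-- The cone over the `C(F -, Y)` with point the unit given by a cocone over `F` with point `Y`. -/
@[simps]
def unitCone {F : J ⥤ C} (s : Cocone F) :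
    Cone (F.op ⋙ (eHomFunctor V C).flip.obj s.pt) where
  pt := 𝟙_ V
  π :=
    { app j := eHomEquiv V (s.ι.app j.unop)
      naturality i j a := by
        refine (id_comp _).trans ?_
        refine Eq.trans ?_ (eHomEquiv_comp_whiskerRight V (F.map a.unop) (s.ι.app i.unop)).symm
        exact congr_arg _ (s.w a.unop).symm }

/-- Conical colimits are colimits in the underlying ordinary category. -/
lemma IsConicalColimit.nonempty_isColimit {F : J ⥤ C} {c : Cocone F}
    (hc : IsConicalColimit V c) : Nonempty (IsColimit c) := by
  have h (Y : C) := (hc Y).some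
  have comp_eHomEquiv {Y : C} (f : c.pt ⟶ Y) (j : J) :
      eHomEquiv V f ≫ eHomWhiskerRight V (c.ι.app j) Y = eHomEquiv V (c.ι.app j ≫ f) :=
    eHomEquiv_comp_whiskerRight V _ _
  let l (s : Cocone F) : 𝟙_ V ⟶ (c.pt ⟶[V] s.pt) := (h s.pt).lift (unitCone s)
  have hl (s : Cocone F) (j : J) : l s ≫ eHomWhiskerRight V (c.ι.app j) s.pt =
      eHomEquiv V (s.ι.app j) := (h s.pt).fac (unitCone s) (op j)
  refine ⟨{
    desc s := (eHomEquiv V).symm (l s)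
    fac s j := ?_
    uniq s m hm := ?_ }⟩
  · apply (eHomEquiv V).injective
    rw [← comp_eHomEquiv, Equiv.apply_symm_apply, hl]
  · apply (eHomEquiv V).injective
    rw [Equiv.apply_symm_apply]
    refine (h s.pt).uniq (unitCone s) _ (fun j ↦ ?_)
    exact (comp_eHomEquiv m j.unop).trans (congr_arg _ (hm j.unop))

lemma IsConicalColimit.of_iso {F : J ⥤ C} {c c' : Cocone F} (hc : IsConicalColimit V c)
    (e : c ≅ c') : IsConicalColimit V c' := fun Y ↦
  ⟨IsLimit.ofIsoLimit (hc Y).some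
    ((Cone.functoriality _ ((eHomFunctor V C).flip.obj Y)).mapIso
      ((coconeEquivalenceOpConeOp F).functor.mapIso e.symm).unop)⟩

/-- When `F` has a conical colimit, every colimit of `F` is conical. -/
lemma isConicalColimit_of_isColimit {F : J ⥤ C} (hF : ∃ c : Cocone F, IsConicalColimit V c)
    {c : Cocone F} (hc : IsColimit c) : IsConicalColimit V c := by
  obtain ⟨c', hc'⟩ := hF
  exact hc'.of_iso (hc'.nonempty_isColimit.some.uniqueUpToIso hc)

variable [HasPullbacks V]

variable (V) in
-- Precomposition in `C^→` is componentwise; this reduces the limit property of `C^→(-, f)` to those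
-- of `C(-, f.left)` and `C(-, f.right)`.
lemma eHomWhiskerRight_arrowHomLeft {g h : Arrow C} (φ : g ⟶ h) (f : Arrow C) :
    eHomWhiskerRight V φ f ≫ arrowHomLeft V g f =
      arrowHomLeft V h f ≫ eHomWhiskerRight V φ.left f.left := by
  change ((λ_ (arrowHom V h f)).inv ≫ arrowHomEquiv V g h φ ▷ _ ≫ arrowComp V g h f) ≫ _ = _
  simp only [assoc, arrowComp, arrowLift_left, whiskerRight_comp_tensorHom_assoc]
  rw [show arrowHomEquiv V g h φ ≫ arrowHomLeft V g h = _ from arrowLift_left _ _ _ _,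
    MonoidalCategory.tensorHom_def'_assoc, ← leftUnitor_inv_naturality_assoc, eHomWhiskerRight]

variable (V) in
lemma eHomWhiskerRight_arrowHomRight {g h : Arrow C} (φ : g ⟶ h) (f : Arrow C) :
    eHomWhiskerRight V φ f ≫ arrowHomRight V g f =
      arrowHomRight V h f ≫ eHomWhiskerRight V φ.right f.right := by
  change ((λ_ (arrowHom V h f)).inv ≫ arrowHomEquiv V g h φ ▷ _ ≫ arrowComp V g h f) ≫ _ = _
  simp only [assoc, arrowComp, arrowLift_right, whiskerRight_comp_tensorHom_assoc]
  rw [show arrowHomEquiv V g h φ ≫ arrowHomRight V g h = _ from arrowLift_right _ _ _ _,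
    MonoidalCategory.tensorHom_def'_assoc, ← leftUnitor_inv_naturality_assoc, eHomWhiskerRight]

/-- A cocone in the `V`-category of arrows is a conical colimit if its components are. -/
lemma isConicalColimit_arrow {F : J ⥤ Arrow C} {c : Cocone F}
    (h₁ : IsConicalColimit V (Arrow.leftFunc.mapCocone c))
    (h₂ : IsConicalColimit V (Arrow.rightFunc.mapCocone c)) :
    IsConicalColimit V c := by
  intro f
  have l₁ (Y : C) := (h₁ Y).some
  have l₂ (Y : C) := (h₂ Y).some
  have hom_ext₁ {Y : C} {X : V} {a b : X ⟶ (c.pt.left ⟶[V] Y)}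
      (hab : ∀ j, a ≫ eHomWhiskerRight V (c.ι.app j).left Y =
        b ≫ eHomWhiskerRight V (c.ι.app j).left Y) : a = b :=
    (l₁ Y).hom_ext (fun j ↦ hab j.unop)
  have hom_ext₂ {Y : C} {X : V} {a b : X ⟶ (c.pt.right ⟶[V] Y)}
      (hab : ∀ j, a ≫ eHomWhiskerRight V (c.ι.app j).right Y =
        b ≫ eHomWhiskerRight V (c.ι.app j).right Y) : a = b :=
    (l₂ Y).hom_ext (fun j ↦ hab j.unop)
  have key (s : Cone (F.op ⋙ (eHomFunctor V (Arrow C)).flip.obj f)) :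
      ∃ a : s.pt ⟶ arrowHom V c.pt f, ∀ j : J,
        a ≫ eHomWhiskerRight V (c.ι.app j) f = s.π.app (op j) := by
    let p (j : J) : s.pt ⟶ arrowHom V (F.obj j) f := s.π.app (op j)
    have hp {i j : J} (u : i ⟶ j) : p j ≫ eHomWhiskerRight V (F.map u) f = p i := s.w u.op
    let s₁ : Cone ((F ⋙ Arrow.leftFunc).op ⋙ (eHomFunctor V C).flip.obj f.left) :=
      ⟨s.pt,
        { app j := p j.unop ≫ arrowHomLeft V _ f
          naturality i j u := by
            have : p j.unop ≫ arrowHomLeft V _ f =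
                (p i.unop ≫ arrowHomLeft V _ f) ≫
                  eHomWhiskerRight V (F.map u.unop).left f.left := by
              rw [assoc, ← eHomWhiskerRight_arrowHomLeft, ← hp u.unop, assoc]
            exact (id_comp _).trans this }⟩
    let s₂ : Cone ((F ⋙ Arrow.rightFunc).op ⋙ (eHomFunctor V C).flip.obj f.right) :=
      ⟨s.pt,
        { app j := p j.unop ≫ arrowHomRight V _ f
          naturality i j u := by
            have : p j.unop ≫ arrowHomRight V _ f =
                (p i.unop ≫ arrowHomRight V _ f) ≫
                  eHomWhiskerRight V (F.map u.unop).right f.right := by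
              rw [assoc, ← eHomWhiskerRight_arrowHomRight, ← hp u.unop, assoc]
            exact (id_comp _).trans this }⟩
    let a : s.pt ⟶ (c.pt.left ⟶[V] f.left) := (l₁ f.left).lift s₁
    let b : s.pt ⟶ (c.pt.right ⟶[V] f.right) := (l₂ f.right).lift s₂
    have ha (j : J) : a ≫ eHomWhiskerRight V (c.ι.app j).left f.left =
      p j ≫ arrowHomLeft V _ f := (l₁ f.left).fac s₁ (op j)
    have hb (j : J) : b ≫ eHomWhiskerRight V (c.ι.app j).right f.right =
      p j ≫ arrowHomRight V _ f := (l₂ f.right).fac s₂ (op j)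
    -- Compatibility of `a` and `b` is an equation between maps into `C(c.pt.left, f.right)`, so it
    -- is tested along the cocone of sources.
    refine ⟨arrowLift V a b (hom_ext₁ (fun j ↦ ?_)), fun j ↦ ?_⟩
    · rw [assoc, assoc, eHom_whisker_exchange, reassoc_of% ha j, arrowHom_w,
        ← eHomWhiskerRight_comp]
      refine Eq.trans ?_ (b ≫= congr_arg (eHomWhiskerRight V · f.right) (c.ι.app j).w.symm)
      refine Eq.trans ?_ (b ≫= (eHomWhiskerRight_comp V _ _ _).symm)
      rw [← reassoc_of% hb j]
    · apply arrowHom_ext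
      · refine (assoc _ _ _).trans ?_
        refine (_ ≫= eHomWhiskerRight_arrowHomLeft V (c.ι.app j) f).trans ?_
        refine (assoc _ _ _).symm.trans ?_
        exact (arrowLift_left V _ _ _ =≫ _).trans (ha j)
      · refine (assoc _ _ _).trans ?_
        refine (_ ≫= eHomWhiskerRight_arrowHomRight V (c.ι.app j) f).trans ?_
        refine (assoc _ _ _).symm.trans ?_
        exact (arrowLift_right V _ _ _ =≫ _).trans (hb j)
  have hom_ext {X : V} {a b : X ⟶ arrowHom V c.pt f}
      (hab : ∀ j, a ≫ eHomWhiskerRight V (c.ι.app j) f =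
        b ≫ eHomWhiskerRight V (c.ι.app j) f) : a = b := by
    apply arrowHom_ext
    · refine hom_ext₁ (fun j ↦ ?_)
      have := hab j =≫ arrowHomLeft V _ f
      rw [assoc, assoc, eHomWhiskerRight_arrowHomLeft] at this
      exact (assoc _ _ _).trans (this.trans (assoc _ _ _).symm)
    · refine hom_ext₂ (fun j ↦ ?_)
      have := hab j =≫ arrowHomRight V _ f
      rw [assoc, assoc, eHomWhiskerRight_arrowHomRight] at this
      exact (assoc _ _ _).trans (this.trans (assoc _ _ _).symm)
  choose l hl using key
  exact ⟨{
    lift s := l s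
    fac s j := hl s j.unop
    uniq s m hm := hom_ext (fun j ↦ (hm (op j)).trans (hl s j).symm) }⟩

end Conical

/-! ### Presentable objects in the enriched and in the ordinary sense -/

section Presentable

variable {V : Type u₁} [Category.{w} V] [MonoidalCategory V]
variable {C : Type u₂} [Category.{w} C] [EnrichedOrdinaryCategory V C]
variable {κ : Cardinal.{w}} [Fact κ.IsRegular]

/-- Morphisms out of `X` are global elements of `C(X, -)`, and the unit is `κ`-presentable. The
hypothesis `hC` makes ordinary colimits conical, so that `hX` applies to them. -/
lemma IsEnrichedPresentable.isCardinalPresentable [IsCardinalPresentable (𝟙_ V) κ]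
    (hC : ∀ (J : Type w) [SmallCategory J] (F : J ⥤ C), ∃ c : Cocone F, IsConicalColimit V c)
    {X : C} (hX : IsEnrichedPresentable V κ X) : IsCardinalPresentable X κ where
  preservesColimitOfShape J _ _ := ⟨fun {F} ↦ ⟨fun {c} hc ↦ ⟨by
    have := isFiltered_of_isCardinalFiltered J κ
    have h := (hX J F c (isConicalColimit_of_isColimit (hC J F) hc)).some
    refine Types.FilteredColimit.isColimitOf' _ _ (fun f ↦ ?_) (fun j f₁ f₂ hf ↦ ?_)
    · change X ⟶ c.pt at f
      obtain ⟨j, g, hg⟩ : ∃ (j : J) (g : 𝟙_ V ⟶ (X ⟶[V] F.obj j)),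
          g ≫ eHomWhiskerLeft V X (c.ι.app j) = eHomEquiv V f :=
        IsCardinalPresentable.exists_hom_of_isColimit κ h (eHomEquiv V f)
      obtain ⟨g, rfl⟩ := (eHomEquiv V).surjective g
      refine ⟨j, g, (eHomEquiv V).injective ?_⟩
      exact hg.symm.trans (eHomEquiv_comp_whiskerLeft V g (c.ι.app j))
    · change X ⟶ F.obj j at f₁ f₂
      obtain ⟨k, a, ha⟩ := IsCardinalPresentable.exists_eq_of_isColimit' κ h (i := j)
        (eHomEquiv V f₁) (eHomEquiv V f₂)
        ((eHomEquiv_comp_whiskerLeft V f₁ (c.ι.app j)).trans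
          ((congr_arg (eHomEquiv V) hf).trans
            (eHomEquiv_comp_whiskerLeft V f₂ (c.ι.app j)).symm))
      exact ⟨k, a, (eHomEquiv V).injective
        ((eHomEquiv_comp_whiskerLeft V f₁ (F.map a)).symm.trans
          (ha.trans (eHomEquiv_comp_whiskerLeft V f₂ (F.map a))))⟩⟩⟩⟩

/-- `C(Y, -)` is a natural retract of `C(X, -)`: elements are sent to `C(X, -)` by `r.r`, handled
there, and returned by `r.i`. -/
lemma IsEnrichedPresentable.of_retract [IsCardinalLocallyPresentable V κ] {X Y : C}
    (hX : IsEnrichedPresentable V κ X) (r : Retract Y X) : IsEnrichedPresentable V κ Y := by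
  intro J _ _ F c hc
  have h := (hX J F c hc).some
  have hr (Z : C) : eHomWhiskerRight V r.r Z ≫ eHomWhiskerRight V r.i Z = 𝟙 _ := by
    rw [← eHomWhiskerRight_comp, r.retract, eHomWhiskerRight_id]
  refine nonempty_isColimit_of_isCardinalPresentable (κ := κ) _ (fun T _ x ↦ ?_)
    (fun T _ j u v huv ↦ ?_)
  · change T ⟶ (Y ⟶[V] c.pt) at x
    obtain ⟨j, y, hy⟩ : ∃ (j : J) (y : T ⟶ (X ⟶[V] F.obj j)),
        y ≫ eHomWhiskerLeft V X (c.ι.app j) = x ≫ eHomWhiskerRight V r.r c.pt :=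
      IsCardinalPresentable.exists_hom_of_isColimit κ h (x ≫ eHomWhiskerRight V r.r c.pt)
    refine ⟨j, y ≫ eHomWhiskerRight V r.i (F.obj j), ?_⟩
    change (_ ≫ _) ≫ eHomWhiskerLeft V Y (c.ι.app j) = x
    rw [assoc, ← eHom_whisker_exchange, reassoc_of% hy]
    exact (x ≫= hr c.pt).trans (comp_id _)
  · change T ⟶ (Y ⟶[V] F.obj j) at u v
    change u ≫ eHomWhiskerLeft V Y (c.ι.app j) = v ≫ eHomWhiskerLeft V Y (c.ι.app j) at huv
    have h₁ : (u ≫ eHomWhiskerRight V r.r (F.obj j)) ≫ eHomWhiskerLeft V X (c.ι.app j) =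
        (v ≫ eHomWhiskerRight V r.r (F.obj j)) ≫ eHomWhiskerLeft V X (c.ι.app j) := by
      rw [assoc, assoc, ← eHom_whisker_exchange, reassoc_of% huv]
    obtain ⟨k, a, ha⟩ := IsCardinalPresentable.exists_eq_of_isColimit' κ h (i := j) _ _ h₁
    replace ha : (u ≫ eHomWhiskerRight V r.r (F.obj j)) ≫ eHomWhiskerLeft V X (F.map a) =
        (v ≫ eHomWhiskerRight V r.r (F.obj j)) ≫ eHomWhiskerLeft V X (F.map a) := ha
    rw [assoc, assoc, ← eHom_whisker_exchange] at ha
    refine ⟨k, a, ?_⟩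
    change u ≫ eHomWhiskerLeft V Y (F.map a) = v ≫ eHomWhiskerLeft V Y (F.map a)
    simpa [hr] using ha =≫ eHomWhiskerRight V r.i (F.obj k)

variable [MonoidalClosed V]

lemma IsEnrichedLocallyPresentable.hasColimits (hC : IsEnrichedLocallyPresentable V C κ) :
    HasColimits C where
  has_colimits_of_shape J _ := ⟨fun F ↦ by
    obtain ⟨c, hc⟩ := hC.exists_conicalColimit J F
    exact ⟨⟨c, hc.nonempty_isColimit.some⟩⟩⟩

lemma IsEnrichedLocallyPresentable.isCardinalFilteredGenerator [IsCardinalPresentable (𝟙_ V) κ]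
    (hC : IsEnrichedLocallyPresentable V C κ) :
    ObjectProperty.IsCardinalFilteredGenerator (fun X : C ↦ IsEnrichedPresentable V κ X) κ where
  le_isCardinalPresentable _ hX := hX.isCardinalPresentable hC.exists_conicalColimit
  exists_colimitsOfShape X := by
    obtain ⟨J, _, _, F, c, hc, ⟨e⟩, hF⟩ := hC.exists_presentation X
    exact ⟨J, inferInstance, inferInstance, ⟨{
      diag := F
      ι := c.ι ≫ (Functor.const J).map e.hom
      isColimit := IsColimit.ofIsoColimit hc.nonempty_isColimit.some (Cocone.ext e)
      prop_diag_obj := hF }⟩⟩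

lemma IsEnrichedLocallyPresentable.isCardinalLocallyPresentable
    [IsCardinalPresentable (𝟙_ V) κ] (hC : IsEnrichedLocallyPresentable V C κ) :
    IsCardinalLocallyPresentable C κ := by
  have := hC.hasColimits
  have := hC.essentiallySmall_presentable
  have := hC.isCardinalFilteredGenerator.hasCardinalFilteredGenerator
  constructor

/-- The enriched presentable objects form a `κ`-filtered generator, so each ordinary `κ`-presentable
object is a retract of one of them. -/
lemma IsEnrichedLocallyPresentable.isEnrichedPresentable [IsCardinalPresentable (𝟙_ V) κ]
    [IsCardinalLocallyPresentable V κ] (hC : IsEnrichedLocallyPresentable V C κ) {X : C}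
    (hX : IsCardinalPresentable X κ) : IsEnrichedPresentable V κ X := by
  have h : isCardinalPresentable C κ X := hX
  rw [hC.isCardinalFilteredGenerator.isPresentable_eq_retractClosure] at h
  obtain ⟨Y, hY, ⟨r⟩⟩ := h
  exact hY.of_retract r

end Presentable

/-! ### Arrows as filtered colimits of arrows between presentable objects -/

section ArrowPresentation

variable {D : Type u₂} [Category.{w} D]

/-- Morphisms of arrows out of `𝟙 X` are morphisms out of `X` into the source. -/
@[simps]
def arrowHomIdEquiv (X : D) (f : Arrow D) : (Arrow.mk (𝟙 X) ⟶ f) ≃ (X ⟶ f.left) where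
  toFun φ := φ.left
  invFun x := Arrow.homMk x (x ≫ f.hom) (by simp)
  left_inv φ := by
    ext
    · rfl
    · exact φ.w.trans (id_comp _)
  right_inv _ := rfl

/-- Morphisms of arrows out of `0 ⟶ X` are morphisms out of `X` into the target. -/
@[simps]
def arrowHomInitialEquiv [HasInitial D] (X : D) (f : Arrow D) :
    (Arrow.mk (initial.to X) ⟶ f) ≃ (X ⟶ f.right) where
  toFun φ := φ.right
  invFun x := Arrow.homMk (initial.to _) x (initialIsInitial.hom_ext _ _)
  left_inv φ := by
    ext
    · exact initialIsInitial.hom_ext _ _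
    · rfl
  right_inv _ := rfl

variable {κ : Cardinal.{w}} [Fact κ.IsRegular]

/-- Evaluation at the source preserves colimits, and `arrowHomIdEquiv` identifies the hom-functor of
`𝟙 X` with evaluation followed by that of `X`. For `0 ⟶ X` the target plays this role. -/
lemma isCardinalPresentable_arrow_id [HasColimits D] (X : D) [IsCardinalPresentable X κ] :
    IsCardinalPresentable (Arrow.mk (𝟙 X)) κ := by
  have : (Arrow.leftFunc : Arrow D ⥤ D).IsCardinalAccessible κ := ⟨fun _ _ _ ↦ inferInstance⟩
  let e : Arrow.leftFunc ⋙ coyoneda.obj (op X) ≅ coyoneda.obj (op (Arrow.mk (𝟙 X))) :=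
    NatIso.ofComponents (fun f ↦ (arrowHomIdEquiv X f).symm.toIso) (fun {f g} φ ↦ by
      ext x
      apply (arrowHomIdEquiv X g).injective
      rfl)
  exact Functor.isCardinalAccessible_of_natIso e κ

lemma isCardinalPresentable_arrow_initial [HasColimits D] (X : D) [IsCardinalPresentable X κ] :
    IsCardinalPresentable (Arrow.mk (initial.to X)) κ := by
  have : (Arrow.rightFunc : Arrow D ⥤ D).IsCardinalAccessible κ := ⟨fun _ _ _ ↦ inferInstance⟩
  let e : Arrow.rightFunc ⋙ coyoneda.obj (op X) ≅ coyoneda.obj (op (Arrow.mk (initial.to X))) :=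
    NatIso.ofComponents (fun f ↦ (arrowHomInitialEquiv X f).symm.toIso) (fun {f g} φ ↦ by
      ext x
      apply (arrowHomInitialEquiv X g).injective
      rfl)
  exact Functor.isCardinalAccessible_of_natIso e κ

/-- The arrows `𝟙 X` and `0 ⟶ X`, for `X` in `P`. -/
def arrowGenerators [HasInitial D] (P : ObjectProperty D) : ObjectProperty (Arrow D) :=
  ObjectProperty.ofObj (fun X : Subtype P ↦ Arrow.mk (𝟙 X.1)) ⊔
    ObjectProperty.ofObj (fun X : Subtype P ↦ Arrow.mk (initial.to X.1))

lemma arrowGenerators_id [HasInitial D] {P : ObjectProperty D} {X : D} (hX : P X) :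
    arrowGenerators P (Arrow.mk (𝟙 X)) :=
  Or.inl (ObjectProperty.ofObj_apply (fun X : Subtype P ↦ Arrow.mk (𝟙 X.1)) ⟨X, hX⟩)

lemma arrowGenerators_initial [HasInitial D] {P : ObjectProperty D} {X : D} (hX : P X) :
    arrowGenerators P (Arrow.mk (initial.to X)) :=
  Or.inr (ObjectProperty.ofObj_apply (fun X : Subtype P ↦ Arrow.mk (initial.to X.1)) ⟨X, hX⟩)

/-- Equality and invertibility of morphisms of arrows are componentwise; `𝟙 G` tests sources and `0
⟶ G` tests targets. -/
lemma isStrongGenerator_arrowGenerators [HasInitial D] {P : ObjectProperty D}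
    (hP : P.IsStrongGenerator) : (arrowGenerators P).IsStrongGenerator := by
  rw [ObjectProperty.isStrongGenerator_iff]
  refine ⟨fun f g φ ψ h ↦ ?_, fun f g i _ hi ↦ ?_⟩
  · ext
    · refine hP.isSeparating _ _ (fun G hG x ↦ ?_)
      exact congr_arg CommaMorphism.left
        (h _ (arrowGenerators_id hG) ((arrowHomIdEquiv G f).symm x))
    · refine hP.isSeparating _ _ (fun G hG x ↦ ?_)
      exact congr_arg CommaMorphism.right
        (h _ (arrowGenerators_initial hG) ((arrowHomInitialEquiv G f).symm x))
  · have : Mono i.left := ⟨fun {Z} a b hab ↦ (arrowHomIdEquiv Z f).symm.injective (by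
      rw [← cancel_mono i]
      apply (arrowHomIdEquiv Z g).injective
      exact hab)⟩
    have : Mono i.right := ⟨fun {Z} a b hab ↦ (arrowHomInitialEquiv Z f).symm.injective (by
      rw [← cancel_mono i]
      apply (arrowHomInitialEquiv Z g).injective
      exact hab)⟩
    have : IsIso i.left := hP.isIso_of_mono _ (fun G hG x ↦ by
      obtain ⟨y, hy⟩ := hi _ (arrowGenerators_id hG) ((arrowHomIdEquiv G g).symm x)
      exact ⟨y.left, congr_arg CommaMorphism.left hy⟩)
    have : IsIso i.right := hP.isIso_of_mono _ (fun G hG x ↦ by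
      obtain ⟨y, hy⟩ := hi _ (arrowGenerators_initial hG) ((arrowHomInitialEquiv G g).symm x)
      exact ⟨y.right, congr_arg CommaMorphism.right hy⟩)
    exact Arrow.isIso_of_isIso_left_of_isIso_right i

variable (D κ) in
/-- The property of arrows of having `κ`-presentable source and target. -/
def hasPresentableEnds : ObjectProperty (Arrow D) :=
  fun f ↦ IsCardinalPresentable f.left κ ∧ IsCardinalPresentable f.right κ

instance : (hasPresentableEnds D κ).IsClosedUnderIsomorphisms where
  of_iso {f _} e h :=
    have : IsCardinalPresentable (Arrow.leftFunc.obj f) κ := h.1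
    have : IsCardinalPresentable (Arrow.rightFunc.obj f) κ := h.2
    ⟨isCardinalPresentable_of_iso (Arrow.leftFunc.mapIso e) κ,
      isCardinalPresentable_of_iso (Arrow.rightFunc.mapIso e) κ⟩

lemma isClosedUnderColimitsOfShape_hasPresentableEnds [HasColimits D] {J : Type w}
    [SmallCategory J] (hJ : HasCardinalLT (Arrow J) κ) :
    (hasPresentableEnds D κ).IsClosedUnderColimitsOfShape J where
  colimitsOfShape_le := by
    rintro X ⟨p⟩
    have h₁ (j : J) : IsCardinalPresentable ((p.diag ⋙ Arrow.leftFunc).obj j) κ :=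
      (p.prop_diag_obj j).1
    have h₂ (j : J) : IsCardinalPresentable ((p.diag ⋙ Arrow.rightFunc).obj j) κ :=
      (p.prop_diag_obj j).2
    exact ⟨isCardinalPresentable_of_isColimit _
        (isColimitOfPreserves Arrow.leftFunc p.isColimit) κ hJ,
      isCardinalPresentable_of_isColimit _
        (isColimitOfPreserves Arrow.rightFunc p.isColimit) κ hJ⟩

/-- In a locally `κ`-presentable category, every arrow is a `κ`-filtered colimit of arrows between
`κ`-presentable objects. -/
lemma exists_colimitsOfShape_hasPresentableEnds [IsCardinalLocallyPresentable D κ] (f : Arrow D) :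
    ∃ (J : Type w) (_ : SmallCategory J) (_ : IsCardinalFiltered J κ),
      (hasPresentableEnds D κ).colimitsOfShape J f := by
  have : HasColimits D := IsCardinalLocallyPresentable.toHasColimitsOfSize (κ := κ)
  obtain ⟨P, _, hP⟩ := HasCardinalFilteredGenerator.exists_small_generator D κ
  have : ObjectProperty.Small.{w} (arrowGenerators P) := by
    dsimp [arrowGenerators]
    infer_instance
  have hgen : arrowGenerators P ≤ isCardinalPresentable (Arrow D) κ := by
    rintro _ (⟨X, hX⟩ | ⟨X, hX⟩)
    · have : IsCardinalPresentable X κ := hP.le_isCardinalPresentable _ hX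
      exact isCardinalPresentable_arrow_id X
    · have : IsCardinalPresentable X κ := hP.le_isCardinalPresentable _ hX
      exact isCardinalPresentable_arrow_initial X
  have hends : arrowGenerators P ≤ hasPresentableEnds D κ := by
    have (k : Discrete PEmpty.{1}) : IsCardinalPresentable ((Functor.empty D).obj k) κ :=
      k.as.elim
    -- The source of `0 ⟶ X` is presentable as a colimit of the empty diagram.
    have h₀ : IsCardinalPresentable (⊥_ D) κ :=
      isCardinalPresentable_of_isColimit (asEmptyCocone (⊥_ D)) initialIsInitial κ
        ((hasCardinalLT_of_finite (Arrow (Discrete PEmpty.{1})) _ le_rfl).of_le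
          (Cardinal.IsRegular.aleph0_le Fact.out))
    rintro _ (⟨X, hX⟩ | ⟨X, hX⟩)
    · exact ⟨hP.le_isCardinalPresentable _ hX, hP.le_isCardinalPresentable _ hX⟩
    · exact ⟨h₀, hP.le_isCardinalPresentable _ hX⟩
  have := (isStrongGenerator_arrowGenerators
    hP.isStrongGenerator).isDense_colimitsCardinalClosure_ι hgen
  have : LocallySmall.{w} (Arrow D) := inferInstance
  -- The closure of the generators under `κ`-small colimits is dense and consists of `κ`-presentable
  -- arrows. Its members still have presentable ends, as that property is stable under `κ`-small
  -- colimits.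
  have h : ((arrowGenerators P).colimitsCardinalClosure κ).IsCardinalFilteredGenerator κ :=
    IsCardinalFilteredGenerator.of_isDense_ι _ κ
      ((arrowGenerators P).colimitsCardinalClosure_le_isCardinalPresentable hgen)
  obtain ⟨J, _, _, hJ⟩ := h.exists_colimitsOfShape f
  exact ⟨J, inferInstance, inferInstance, ObjectProperty.colimitsOfShape_monotone J
    ((arrowGenerators P).colimitsCardinalClosure_le κ
      (fun _ _ hJ ↦ isClosedUnderColimitsOfShape_hasPresentableEnds hJ) hends) _ hJ⟩

end ArrowPresentation

/-! ### Bare purity in locally presentable `V`-categories -/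

section Main

variable {V : Type u₁} [Category.{w} V] [MonoidalCategory V] [MonoidalClosed V]
  [HasPullbacks V]
variable {κ : Cardinal.{w}} [Fact κ.IsRegular] {E M : MorphismProperty V}
  [IsFactorizationSystem E M]
variable {C : Type u₂} [Category.{w} C] [EnrichedOrdinaryCategory V C]

lemma IsBarelyPure.isFilteredColimit [IsCardinalPresentable (𝟙_ V) κ]
    [IsCardinalLocallyPresentable V κ] (hC : IsEnrichedLocallyPresentable V C κ) {f : Arrow C}
    (hf : IsBarelyPure E M κ f) : IsFilteredColimitOfBarelyPureFor E M κ f := by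
  have := hC.isCardinalLocallyPresentable
  have := hC.hasColimits
  obtain ⟨J, _, _, ⟨p⟩⟩ := exists_colimitsOfShape_hasPresentableEnds (κ := κ) f
  refine ⟨J, inferInstance, inferInstance, p.diag, p.cocone, ?_, ⟨Iso.refl _⟩, fun j ↦
    hf (p.diag.obj j).hom (hC.isEnrichedPresentable (p.prop_diag_obj j).1)
      (hC.isEnrichedPresentable (p.prop_diag_obj j).2)⟩
  -- Sources and targets form ordinary colimits in `C`, which are conical because `C` has all
  -- conical colimits.
  exact isConicalColimit_arrow
    (isConicalColimit_of_isColimit (hC.exists_conicalColimit _ _)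
      (isColimitOfPreserves Arrow.leftFunc p.isColimit))
    (isConicalColimit_of_isColimit (hC.exists_conicalColimit _ _)
      (isColimitOfPreserves Arrow.rightFunc p.isColimit))

lemma IsFilteredColimitOfBarelyPureFor.isBarelyPure [BraidedCategory V] [HasInitial V]
    [IsCardinalLocallyPresentable V κ]
    (hEM : StandingAssumption κ E M) (hC : IsEnrichedLocallyPresentable V C κ) {f : Arrow C}
    (hf : IsFilteredColimitOfBarelyPureFor E M κ f) : IsBarelyPure E M κ f := by
  have := hC.hasColimits
  obtain ⟨J, _, _, F, c, hc, ⟨e⟩, hF⟩ := hf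
  -- Making `f` the cocone point itself avoids transporting purity along `e`. Only the ordinary
  -- colimit is kept; conicality of its components is recovered from `hC`.
  obtain ⟨c, hc, rfl⟩ : ∃ (c : Cocone F) (_ : IsColimit c), c.pt = f :=
    ⟨c.extend e.hom, hc.nonempty_isColimit.some.extendIso e.hom, rfl⟩
  intro A B g hA hB
  have hl := isConicalColimit_of_isColimit (V := V) (hC.exists_conicalColimit _ _)
    (isColimitOfPreserves Arrow.leftFunc hc)
  have hr := isConicalColimit_of_isColimit (V := V) (hC.exists_conicalColimit _ _)
    (isColimitOfPreserves Arrow.rightFunc hc)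
  have h₁ := (hA J _ _ hl).some
  have h₂ := (nonempty_isColimit_arrowHomFunctor (κ := κ) (V := V) (Arrow.mk g) c h₁
    (hB J _ _ hr).some (hA J _ _ hr).some).some
  refine isBarelyPureWrt_of_forall_exists hEM _ _ (fun X _ x ↦ ?_)
  obtain ⟨j, y, hy⟩ := exists_comp_middleMap_eq hEM (Arrow.mk g) c h₁ h₂ x
  exact ⟨F.obj j, c.ι.app j, y, hF j, hy⟩

end Main

end

end EnrichedPurity

theorem mainTheorem9 (V : Type u₁) [Category.{w} V] [MonoidalCategory V] [SymmetricCategory V]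
    [MonoidalClosed V] [HasLimits V] [HasColimits V]
    (κ : Cardinal.{w}) [Fact κ.IsRegular]
    (hV : EnrichedPurity.IsLocallyPresentableAsClosedCategory V κ)
    (E M : MorphismProperty V) [EnrichedPurity.IsFactorizationSystem E M]
    (hEM : EnrichedPurity.StandingAssumption κ E M) :
    (∀ (C : Type u₂) [Category.{w} C] [EnrichedOrdinaryCategory V C],
      EnrichedPurity.IsEnrichedLocallyPresentable V C κ →
      ∀ {K L : C} (f : K ⟶ L),
        EnrichedPurity.IsBarelyPure E M κ (Arrow.mk f) ↔
          EnrichedPurity.IsFilteredColimitOfBarelyPureFor E M κ (Arrow.mk f)) ∧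
    (∀ (C : Type u₃) [Category.{w} C] [EnrichedOrdinaryCategory V C] {K L : C} (s : K ⟶ L),
      EnrichedPurity.IsSplitMonoWrt E s →
        EnrichedPurity.IsBarelyPure E M κ (Arrow.mk s)) := by
  have := hV.isCardinalLocallyPresentable
  have := hV.isCardinalPresentable_unit
  exact ⟨fun C _ _ hC K L f ↦ ⟨fun hf ↦ hf.isFilteredColimit hC, fun hf ↦ hf.isBarelyPure hEM hC⟩,
    fun C _ _ K L s hs A B g _ _ ↦ hs.isBarelyPureWrt hEM (Arrow.mk g)⟩
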